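/- For a permutation $f$ of $\{0,1\}^n$ let $\tilde f(y,x)=(f(y),x)$, and let $h(y,x)=y\cdot x$ be the inner product modulo two, for $x,y\in\{0,1\}^n$. A function $G:\{0,1\}^n\times\{0,1\}^n\to\{0,1\}$ *$(\delta,\varepsilon)$-predicts $h$ from $\tilde f$* if $$\Pr_y\Big[\Pr_x[G(\tilde f(y,x))=h(y,x)]\ge \tfrac12+\varepsilon\Big]\ge\delta ,$$ where $x,y$ are uniform in $\{0,1\}^n$. In the classical GL$^*$ problem with parameters $n,\delta,\varepsilon$, a classical probabilistic query algorithm (a random adaptive decision tree, with unrestricted computation) receives $b=f(a)$, where $f$ is a uniformly random permutation of $\{0,1\}^n$ and $a\in\{0,1\}^n$ is uniformly random and independent of $f$. It may make $f$-queries (input $y$, answer $f(y)$) and $G$-queries (input $(y,x)$, answer $G_f(y,x)$), and it must output $a$. It solves the problem if, for every assignment $f\mapsto G_f$ of functions such that $G_f$ $(\delta,\varepsilon)$-predicts $h$ from $\tilde f$ for every $f$, its success probability over $f$, $a$ and its own coins is at least $\delta/2$. **Theorem.** There is an absolute constant $c>0$ such that, for all $n$, all $\delta$ with $2^{-n/2}\le\delta\le1$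 and all $\varepsilon$ with $\sqrt n\,2^{-n/4}\le\varepsilon\le\frac12$, every classical algorithm that solves the GL$^*$ problem with parameters $n,\delta,\varepsilon$, making in every run at most $T_f$ $f$-queries and at most $T_G$ $G$-queries, satisfies $$T_f\ge c\,2^{n/2}\qquad\text{or}\qquad T_G\ge c\,\frac{n}{\varepsilon^2}.$$ (For $n=0$ the second inequality is read as $T_G\ge 0$.) -/

import Mathlib

namespace GLStar

/-- Bit strings of length `n`, as vectors over the field with two elements. -/
abbrev Bits (n : ℕ) : Type := Fin n → ZMod 2

/-- Probability of the event `p` for a uniformly random element of a finite type. -/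
noncomputable def prob {α : Type*} [Fintype α] (p : α → Prop) : ℝ :=
  (Nat.card {a : α // p a} : ℝ) / (Fintype.card α : ℝ)

/-- The predicate `h(y, x) = y · x`, the inner product modulo two. -/
def h {n : ℕ} (p : Bits n × Bits n) : ZMod 2 := p.1 ⬝ᵥ p.2

/-- The permutation `(y, x) ↦ (f y, x)` attached to a permutation `f`. -/
def tilde {n : ℕ} (f : Equiv.Perm (Bits n)) : Equiv.Perm (Bits n × Bits n) :=
  Equiv.prodCongr f (Equiv.refl (Bits n))

/-- `y` is `ε`-good for `G`: `Pr_x [G (f̃ (y, x)) = h (y, x)] ≥ 1/2 + ε`. -/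
def IsGood {n : ℕ} (ε : ℝ) (f : Equiv.Perm (Bits n)) (G : Bits n × Bits n → ZMod 2)
    (y : Bits n) : Prop :=
  1 / 2 + ε ≤ prob fun x : Bits n => G (tilde f (y, x)) = h (y, x)

/-- `G` `(δ, ε)`-predicts `h` from `f̃`: `Pr_y [y is ε-good] ≥ δ`. -/
def Predicts {n : ℕ} (δ ε : ℝ) (f : Equiv.Perm (Bits n)) (G : Bits n × Bits n → ZMod 2) : Prop :=
  δ ≤ prob fun y : Bits n => IsGood ε f G y

/-- Deterministic adaptive query algorithms (decision trees). The next step may depend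
arbitrarily on all the answers obtained so far. -/
inductive QueryTree (n : ℕ) : Type
  | output (a : Bits n) : QueryTree n
  | queryF (y : Bits n) (next : Bits n → QueryTree n) : QueryTree n
  | queryG (p : Bits n × Bits n) (next : ZMod 2 → QueryTree n) : QueryTree n

namespace QueryTree

variable {n : ℕ}

/-- The output of a decision tree when the queries are answered by `f` and `G`. -/
def run (f : Equiv.Perm (Bits n)) (G : Bits n × Bits n → ZMod 2) : QueryTree n → Bits n
  | output a => a
  | queryF y next => run f G (next (f y))
  | queryG p next => run f G (next (G p))

/-- The number of `f`-queries made when the queries are answered by `f` and `G`. -/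
def numF (f : Equiv.Perm (Bits n)) (G : Bits n × Bits n → ZMod 2) : QueryTree n → ℕ
  | output _ => 0
  | queryF y next => numF f G (next (f y)) + 1
  | queryG p next => numF f G (next (G p))

/-- The number of `G`-queries made when the queries are answered by `f` and `G`. -/
def numG (f : Equiv.Perm (Bits n)) (G : Bits n × Bits n → ZMod 2) : QueryTree n → ℕ
  | output _ => 0
  | queryF y next => numG f G (next (f y))
  | queryG p next => numG f G (next (G p)) + 1

end QueryTree

/-- A deterministic algorithm: the problem instance `b` determines the decision tree. -/
abbrev DetAlg (n : ℕ) : Type := Bits n → QueryTree n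

/-- A classical probabilistic algorithm: a random deterministic one, chosen independently of
the problem instance and of the black boxes. -/
abbrev RandAlg (n : ℕ) : Type := PMF (DetAlg n)

/-- The probability, over a uniformly random permutation `f`, a uniformly random `a` and the
coins of the algorithm, that on input `b = f a`, with black boxes `f` and `G f`, it outputs `a`.
The predictor may depend on `f`, but neither on `a` nor on the coins. -/
noncomputable def successProb {n : ℕ} (A : RandAlg n)
    (G : Equiv.Perm (Bits n) → Bits n × Bits n → ZMod 2) : ℝ :=
  ∑' D : DetAlg n, (A D).toReal *
    prob fun q : Equiv.Perm (Bits n) × Bits n => (D (q.1 q.2)).run q.1 (G q.1) = q.2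

/-- `A` solves the GL* problem with parameters `δ, ε`: whatever `(δ, ε)`-predictors are supplied,
it inverts a random permutation at a random point with probability at least `δ / 2`. -/
def Solves {n : ℕ} (δ ε : ℝ) (A : RandAlg n) : Prop :=
  ∀ G : Equiv.Perm (Bits n) → Bits n × Bits n → ZMod 2,
    (∀ f, Predicts δ ε f (G f)) → δ / 2 ≤ successProb A G

/-- In every run of the GL* problem, whatever the coins, `A` makes at most `TF` `f`-queries and at
most `TG` `G`-queries. -/
def QueryBound {n : ℕ} (δ ε : ℝ) (A : RandAlg n) (TF TG : ℕ) : Prop :=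
  ∀ D ∈ A.support, ∀ (f : Equiv.Perm (Bits n)) (G : Bits n × Bits n → ZMod 2) (a : Bits n),
    Predicts δ ε f G → (D (f a)).numF f G ≤ TF ∧ (D (f a)).numG f G ≤ TG

end GLStar

/-! Fix a set `B` of about `δ 2ⁿ` images and let `G` be random: on the rows in `B` its values are
independent and correct with probability `1/2 + β`, on the other rows they are fair coins. For
`β = 2ε` Hoeffding's inequality and a union bound show that `G` predicts with probability at least
`1/2`.

Consider an algorithm with challenge `b = f a`, making `T` queries in all. If `b ∉ B`, then `G`
carries no information on `f⁻¹ b`. Exchanging `f⁻¹ b` with a random point changes the run only if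
one of its queries touches one of the two points, so `f⁻¹ b` is found with probability
`p ≤ 2(T + 1)/2ⁿ`. If `b ∈ B`, make the row of `b` uninformative as well: this changes the law of
each value of `G` by a `χ²`-divergence of at most `4β²`, and `T_G` queries can raise the success
probability from `p` to at most `√((1 + 4β²)^{T_G} p)`, a small constant when `T_G ≤ c n/ε²`.
Averaged over `b`, the success probability is at most `O(T/2ⁿ)` plus a small multiple of `δ`. As
`2ⁿ ≥ 2^{n/2}/δ`, this is below `δ/2` for some choice of predictors when both query bounds are
small. -/

namespace GLStar

open scoped BigOperators

section ProductMean

variable {ι α : Type*} [Fintype ι] [Fintype α] [DecidableEq ι] {k q : ι → α → ℝ}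

/-- The mean of `F` over tuples whose `i`-th coordinate has law `k i`, independently of the
other coordinates. Laws on a finite type are real weights, points of `stdSimplex ℝ α`. -/
noncomputable def productMean (k : ι → α → ℝ) (F : (ι → α) → ℝ) : ℝ :=
  ∑ g, (∏ i, k i (g i)) * F g

/-- The probability of the event `S` when the coordinates are independent with laws `k i`. -/
noncomputable def productProb (k : ι → α → ℝ) (S : Set (ι → α)) : ℝ :=
  productMean k (S.indicator fun _ => 1)

theorem productMean_prod (k F : ι → α → ℝ) :
    productMean k (fun g => ∏ i, F i (g i)) = ∏ i, ∑ v, k i v * F i v := by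
  simp only [productMean, ← Finset.prod_mul_distrib, Finset.prod_univ_sum, Fintype.piFinset_univ]

theorem productMean_const (hk : ∀ i, ∑ v, k i v = 1) (c : ℝ) :
    productMean k (fun _ => c) = c := by
  have total : ∑ g : ι → α, ∏ i, k i (g i) = 1 := by
    rw [← Fintype.piFinset_univ, ← Finset.prod_univ_sum, Finset.prod_eq_one fun i _ => hk i]
  rw [productMean, ← Finset.sum_mul, total, one_mul]

theorem productMean_const_mul (k : ι → α → ℝ) (c : ℝ) (F : (ι → α) → ℝ) :
    productMean k (fun g => c * F g) = c * productMean k F := by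
  simp only [productMean, Finset.mul_sum, mul_left_comm]

theorem productMean_sum {J : Type*} (k : ι → α → ℝ) (s : Finset J) (F : J → (ι → α) → ℝ) :
    productMean k (fun g => ∑ j ∈ s, F j g) = ∑ j ∈ s, productMean k (F j) := by
  simp only [productMean, Finset.mul_sum]
  exact Finset.sum_comm

theorem productMean_expect {J : Type*} [Fintype J] (k : ι → α → ℝ) (F : J → (ι → α) → ℝ) :
    productMean k (fun g => 𝔼 j, F j g) = 𝔼 j, productMean k (F j) := by
  simp only [productMean, Finset.mul_expect]
  exact (Finset.expect_sum_comm _ _ _).symm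

theorem productMean_mono (hk : ∀ i v, 0 ≤ k i v) {F F' : (ι → α) → ℝ} (h : ∀ g, F g ≤ F' g) :
    productMean k F ≤ productMean k F' :=
  Finset.sum_le_sum fun g _ =>
    mul_le_mul_of_nonneg_left (h g) (Finset.prod_nonneg fun i _ => hk i (g i))

theorem productMean_comp_equiv {e : ι → α ≃ α} (h : ∀ i v, q i (e i v) = k i v)
    (F : (ι → α) → ℝ) : productMean k (fun g => F fun i => e i (g i)) = productMean q F :=
  Fintype.sum_equiv (Equiv.piCongrRight e) _ _ fun g => by
    simp only [Equiv.piCongrRight_apply, Pi.map_apply, h]; rfl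

theorem productMean_eq_sum_update (hk : ∀ i, ∑ v, k i v = 1) (i : ι) (F : (ι → α) → ℝ) :
    productMean k F = ∑ v, k i v * productMean k fun g => F (Function.update g i v) := by
  let exchange : (ι → α) × α → (ι → α) × α := fun p => (Function.update p.1 i p.2, p.1 i)
  have involutive : Function.Involutive exchange := fun p => by simp [exchange]
  have weight (g : ι → α) (v : α) :
      (∏ j, k j (Function.update g i v j)) * k i (g i) = (∏ j, k j (g j)) * k i v := by
    rw [← Finset.mul_prod_erase _ _ (Finset.mem_univ i),
      ← Finset.mul_prod_erase _ (fun j => k j (g j)) (Finset.mem_univ i), Function.update_self,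
      Finset.prod_congr rfl fun j hj => by rw [Function.update_of_ne (Finset.ne_of_mem_erase hj)]]
    ring
  calc productMean k F
      = ∑ p : (ι → α) × α, (∏ j, k j (p.1 j)) * k i p.2 * F p.1 := by
        simp only [productMean, Fintype.sum_prod_type, mul_right_comm _ (k i _), ← Finset.mul_sum,
          hk, mul_one]
    _ = ∑ p : (ι → α) × α, (∏ j, k j (p.1 j)) * k i p.2 * F (Function.update p.1 i p.2) :=
        Fintype.sum_equiv involutive.toPerm _ _ fun p => by simp [exchange, weight]
    _ = _ := by
        simp only [productMean, Fintype.sum_prod_type_right, Finset.mul_sum]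
        exact Finset.sum_congr rfl fun v _ => Finset.sum_congr rfl fun g _ => by ring

theorem productProb_mono (hk : ∀ i v, 0 ≤ k i v) {S S' : Set (ι → α)} (h : S ⊆ S') :
    productProb k S ≤ productProb k S' :=
  productMean_mono hk <| Set.indicator_le_indicator_of_subset h fun _ => zero_le_one

theorem productProb_eq_zero {S : Set (ι → α)} (h : ∀ g ∈ S, ∃ i, k i (g i) = 0) :
    productProb k S = 0 :=
  Finset.sum_eq_zero fun g _ => by
    by_cases hg : g ∈ S
    · obtain ⟨i, hi⟩ := h g hg
      rw [Finset.prod_eq_zero (Finset.mem_univ i) hi, zero_mul]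
    · rw [Set.indicator_of_notMem hg, mul_zero]

theorem productProb_add_compl (hk : ∀ i, ∑ v, k i v = 1) (S : Set (ι → α)) :
    productProb k S + productProb k Sᶜ = 1 := by
  rw [← productMean_const hk 1, ← Set.indicator_self_add_compl S fun _ => (1 : ℝ)]
  simp only [productProb, productMean, Pi.add_apply, mul_add, Finset.sum_add_distrib]

theorem productProb_biUnion_le {J : Type*} (hk : ∀ i v, 0 ≤ k i v) (s : Finset J)
    (A : J → Set (ι → α)) : productProb k (⋃ j ∈ s, A j) ≤ ∑ j ∈ s, productProb k (A j) := by
  simp only [productProb, ← productMean_sum]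
  have nonneg (j : J) (g : ι → α) : (0 : ℝ) ≤ (A j).indicator (fun _ => 1) g :=
    Set.indicator_nonneg (fun _ _ => zero_le_one) g
  refine productMean_mono hk <| Set.indicator_le' (fun g hg => ?_)
    fun g _ => Finset.sum_nonneg fun j _ => nonneg j g
  obtain ⟨j, hj, hgj⟩ := Set.mem_iUnion₂.1 hg
  calc (1 : ℝ) = (A j).indicator (fun _ => 1) g := by rw [Set.indicator_of_mem hgj]
    _ ≤ _ := Finset.single_le_sum (fun j _ => nonneg j g) hj

end ProductMean

section Hoeffding

open MeasureTheory ProbabilityTheory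

variable {ι α : Type*} [Fintype α]

theorem sum_mul_exp_sub_mean_le {k : α → ℝ} (hk : k ∈ stdSimplex ℝ α) {X : α → ℝ}
    (hX : ∀ v, X v ∈ Set.Icc 0 1) (l : ℝ) :
    ∑ v, k v * Real.exp (l * (X v - ∑ w, k w * X w)) ≤ Real.exp (l ^ 2 / 8) := by
  let _ : MeasurableSpace α := ⊤
  let μ : PMF α := PMF.ofFintype (fun v => ENNReal.ofReal (k v)) <| by
    rw [← ENNReal.ofReal_sum_of_nonneg fun v _ => hk.1 v, hk.2, ENNReal.ofReal_one]
  have mean (F : α → ℝ) : ∫ v, F v ∂μ.toMeasure = ∑ v, k v * F v := by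
    simp [PMF.integral_eq_sum, μ, ENNReal.toReal_ofReal (hk.1 _)]
  have subgaussian := hasSubgaussianMGF_of_mem_Icc (μ := μ.toMeasure) (X := X) (a := 0) (b := 1)
    measurable_from_top.aemeasurable (ae_of_all _ hX)
  have laplace := subgaussian.mgf_le l
  simp only [mgf, mean] at laplace
  convert laplace using 2
  norm_num
  ring

variable [Fintype ι] [DecidableEq ι]

theorem productMean_exp_sum_le {k : ι → α → ℝ} (hk : ∀ i, k i ∈ stdSimplex ℝ α)
    {X : ι → α → ℝ} (hX : ∀ i v, X i v ∈ Set.Icc 0 1) (s : Finset ι) (l : ℝ) :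
    productMean k (fun g => Real.exp (l * ∑ i ∈ s, (X i (g i) - ∑ v, k i v * X i v))) ≤
      Real.exp (s.card * (l ^ 2 / 8)) := by
  let Z (i : ι) (v : α) : ℝ :=
    if i ∈ s then Real.exp (l * (X i v - ∑ w, k i w * X i w)) else 1
  have factor (g : ι → α) :
      Real.exp (l * ∑ i ∈ s, (X i (g i) - ∑ v, k i v * X i v)) = ∏ i, Z i (g i) := by
    simp only [Z, Finset.prod_ite_mem, Finset.univ_inter, ← Real.exp_sum, ← Finset.mul_sum]
  have laplace (i : ι) : ∑ v, k i v * Z i v ≤ if i ∈ s then Real.exp (l ^ 2 / 8) else 1 := by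
    by_cases hi : i ∈ s
    · simpa only [Z, hi, if_true] using sum_mul_exp_sub_mean_le (hk i) (hX i) l
    · simp [Z, hi, (hk i).2]
  calc productMean k (fun g => Real.exp (l * ∑ i ∈ s, (X i (g i) - ∑ v, k i v * X i v)))
      = ∏ i, ∑ v, k i v * Z i v := by simp only [factor, productMean_prod]
    _ ≤ ∏ i, if i ∈ s then Real.exp (l ^ 2 / 8) else 1 := by
        refine Finset.prod_le_prod (fun i _ => Finset.sum_nonneg fun v _ => ?_) fun i _ => laplace i
        have := (hk i).1 v
        positivity
    _ = Real.exp (s.card * (l ^ 2 / 8)) := by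
        rw [Finset.prod_ite_mem, Finset.univ_inter, Finset.prod_const, ← Real.exp_nat_mul]

theorem productProb_sum_le_le_exp {k : ι → α → ℝ} (hk : ∀ i, k i ∈ stdSimplex ℝ α)
    {X : ι → α → ℝ} (hX : ∀ i v, X i v ∈ Set.Icc 0 1) (s : Finset ι) {t : ℝ} (ht : 0 ≤ t) :
    productProb k {g | ∑ i ∈ s, (X i (g i) - ∑ v, k i v * X i v) ≤ -t} ≤
      Real.exp (-2 * t ^ 2 / s.card) := by
  let l := 4 * t / s.card
  calc productProb k {g | ∑ i ∈ s, (X i (g i) - ∑ v, k i v * X i v) ≤ -t}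
      ≤ productMean k fun g => Real.exp (-l * t) *
          Real.exp (-l * ∑ i ∈ s, (X i (g i) - ∑ v, k i v * X i v)) := by
        refine productMean_mono (fun i => (hk i).1) <| Set.indicator_le' (fun g hg => ?_)
          fun g _ => by positivity
        rw [← Real.exp_add, Real.one_le_exp_iff]
        have hl : 0 ≤ l := by positivity
        have deviation : ∑ i ∈ s, (X i (g i) - ∑ v, k i v * X i v) ≤ -t := hg
        nlinarith
    _ = Real.exp (-l * t) *
          productMean k fun g => Real.exp (-l * ∑ i ∈ s, (X i (g i) - ∑ v, k i v * X i v)) :=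
        productMean_const_mul _ _ _
    _ ≤ Real.exp (-l * t) * Real.exp (s.card * ((-l) ^ 2 / 8)) := by
        gcongr
        exact productMean_exp_sum_le hk hX s (-l)
    _ = Real.exp (-2 * t ^ 2 / s.card) := by
        rw [← Real.exp_add]
        congr 1
        obtain hs | hs := eq_or_ne (s.card : ℝ) 0
        · simp only [l, hs, div_zero, neg_zero, zero_mul, add_zero]
        · simp only [l]
          field_simp
          ring

end Hoeffding
section ChangeOfMeasure

variable {ι α β : Type*}

/-- The law `k` has `χ²`-divergence at most `κ - 1` from `q`. This variational form of
`∑ v, k v ^ 2 / q v ≤ κ` makes sense where `q` vanishes. -/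
def ChiSqLE [Fintype α] (κ : ℝ) (k q : α → ℝ) : Prop :=
  ∀ u : α → ℝ, (∑ v, k v * u v) ^ 2 ≤ κ * ∑ v, q v * u v ^ 2

theorem chiSqLE_self [Fintype α] {κ : ℝ} (hκ : 1 ≤ κ) {k : α → ℝ} (hk : k ∈ stdSimplex ℝ α) :
    ChiSqLE κ k k := fun u =>
  calc (∑ v, k v * u v) ^ 2 ≤ ∑ v, k v * u v ^ 2 :=
        Real.pow_arith_mean_le_arith_mean_pow_of_even _ _ _ (fun v _ => hk.1 v) hk.2 even_two
    _ ≤ κ * ∑ v, k v * u v ^ 2 :=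
        le_mul_of_one_le_left
          (Finset.sum_nonneg fun v _ => mul_nonneg (hk.1 v) (sq_nonneg (u v))) hκ

variable [DecidableEq ι]

/-- `F` can be evaluated by a decision tree reading at most `m` coordinates of its argument:
after the first coordinate `i` is read to be `v`, depth `m` remains for `F` with that
coordinate set to `v`. -/
inductive DecisionDepthLE : ℕ → ((ι → α) → β) → Prop
  | const (m : ℕ) (c : β) : DecisionDepthLE m fun _ => c
  | query {m : ℕ} {F : (ι → α) → β} (i : ι)
      (next : ∀ v, DecisionDepthLE m fun g => F (Function.update g i v)) :
      DecisionDepthLE (m + 1) F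

namespace DecisionDepthLE

theorem comp {γ : Type*} {m : ℕ} {F : (ι → α) → β} (hF : DecisionDepthLE m F) (φ : β → γ) :
    DecisionDepthLE m fun g => φ (F g) := by
  induction hF with
  | const m c => exact .const m (φ c)
  | query i _ ih => exact .query i ih

theorem comp_update {m : ℕ} {F : (ι → α) → β} (hF : DecisionDepthLE m F) (i : ι) (v : α) :
    DecisionDepthLE m fun g => F (Function.update g i v) := by
  induction hF with
  | const m c => exact .const m c
  | query j _ ih =>
    refine .query j fun w => ?_
    obtain rfl | hij := eq_or_ne i j
    · simpa only [Function.update_idem] using ih v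
    · simpa only [Function.update_comm hij] using ih w

theorem sq_productMean_le [Fintype ι] [Fintype α] {κ : ℝ} (hκ : 1 ≤ κ) {k q : ι → α → ℝ}
    (hk : ∀ i, ∑ v, k i v = 1) (hq : ∀ i, q i ∈ stdSimplex ℝ α)
    (hkq : ∀ i, ChiSqLE κ (k i) (q i)) {m : ℕ} {F : (ι → α) → ℝ} (hF : DecisionDepthLE m F) :
    productMean k F ^ 2 ≤ κ ^ m * productMean q fun g => F g ^ 2 := by
  induction hF with
  | const m c =>
    rw [productMean_const hk, productMean_const fun i => (hq i).2]
    exact le_mul_of_one_le_left (sq_nonneg c) (one_le_pow₀ hκ)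
  | @query m F i _ ih =>
    let Q v := productMean q fun g => F (Function.update g i v) ^ 2
    calc productMean k F ^ 2
        = (∑ v, k i v * productMean k fun g => F (Function.update g i v)) ^ 2 := by
          rw [productMean_eq_sum_update hk i]
      _ ≤ κ * ∑ v, q i v * (productMean k fun g => F (Function.update g i v)) ^ 2 := hkq i _
      _ ≤ κ * ∑ v, q i v * (κ ^ m * Q v) := by
          gcongr with v
          · exact (hq i).1 v
          · exact ih v
      _ = κ ^ (m + 1) * ∑ v, q i v * Q v := by
          simp only [mul_left_comm _ (κ ^ m), ← Finset.mul_sum]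
          ring
      _ = κ ^ (m + 1) * productMean q fun g => F g ^ 2 := by
          rw [productMean_eq_sum_update (fun i => (hq i).2) i]

theorem sq_productProb_le [Fintype ι] [Fintype α] {κ : ℝ} (hκ : 1 ≤ κ) {k q : ι → α → ℝ}
    (hk : ∀ i, ∑ v, k i v = 1) (hq : ∀ i, q i ∈ stdSimplex ℝ α)
    (hkq : ∀ i, ChiSqLE κ (k i) (q i)) {m : ℕ} {S : Set (ι → α)}
    (hS : DecisionDepthLE m fun g => g ∈ S) :
    productProb k S ^ 2 ≤ κ ^ m * productProb q S := by
  classical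
  have hF : DecisionDepthLE m (S.indicator fun _ => (1 : ℝ)) := by
    convert hS.comp fun p => if p then (1 : ℝ) else 0 using 2 with g
    exact Set.indicator_apply S _ g
  have idempotent : (fun g => S.indicator (fun _ => (1 : ℝ)) g ^ 2) = S.indicator fun _ => 1 := by
    funext g
    by_cases hg : g ∈ S <;> simp [hg]
  refine (hF.sq_productMean_le hκ hk hq hkq).trans_eq ?_
  rw [idempotent, productProb]

end DecisionDepthLE

end ChangeOfMeasure

section Coin

/-- The law of a bit that equals `c` with probability `1 / 2 + β`. -/
noncomputable def coin (β : ℝ) (c v : ZMod 2) : ℝ := if v = c then 1 / 2 + β else 1 / 2 - β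

theorem coin_zero (c v : ZMod 2) : coin 0 c v = 1 / 2 := by simp [coin]

theorem coin_add (β : ℝ) (c c' v : ZMod 2) : coin β (c + c') (v + c') = coin β c v := by
  simp only [coin, add_left_inj]

theorem sum_coin_mul (β : ℝ) (c : ZMod 2) (F : ZMod 2 → ℝ) :
    ∑ v, coin β c v * F v = (1 / 2 + β) * F c + (1 / 2 - β) * F (c + 1) := by
  have sum_bits : ∑ v, coin β c v * F v = coin β c 0 * F 0 + coin β c 1 * F 1 := Fin.sum_univ_two _
  have bit : c = 0 ∨ c = 1 := by clear sum_bits F; decide +revert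
  rw [sum_bits]
  obtain rfl | rfl := bit
  · simp [coin]
  · rw [show (1 + 1 : ZMod 2) = 0 from rfl]
    simp [coin, add_comm]

theorem coin_mem_stdSimplex {β : ℝ} (hβ : |β| ≤ 1 / 2) (c : ZMod 2) :
    coin β c ∈ stdSimplex ℝ (ZMod 2) := by
  obtain ⟨hlow, hhigh⟩ := abs_le.1 hβ
  refine ⟨fun v => ?_, ?_⟩
  · unfold coin
    split_ifs <;> linarith
  · have total := sum_coin_mul β c 1
    simp only [Pi.one_apply, mul_one] at total
    linarith

theorem chiSqLE_coin (β : ℝ) (c c' : ZMod 2) :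
    ChiSqLE (1 + 4 * β ^ 2) (coin β c) (coin 0 c') := fun u => by
  have uniform : coin 0 c' = coin 0 c := by funext v; simp only [coin_zero]
  rw [uniform, sum_coin_mul, sum_coin_mul]
  nlinarith [sq_nonneg ((1 / 2 - β) * u c - (1 / 2 + β) * u (c + 1))]

end Coin
namespace QueryTree

variable {n : ℕ}

/-- Stop, with an arbitrary output, as soon as more than `s` `f`-queries or more than `m`
`G`-queries would be made. -/
def trunc : QueryTree n → ℕ → ℕ → QueryTree n
  | .output a, _, _ => .output a
  | .queryF _ _, 0, _ => .output 0
  | .queryF y next, s + 1, m => .queryF y fun z => (next z).trunc s m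
  | .queryG _ _, _, 0 => .output 0
  | .queryG p next, s, m + 1 => .queryG p fun v => (next v).trunc s m

/-- The points at which `f` is queried, together with the output. -/
def points (f : Equiv.Perm (Bits n)) (G : Bits n × Bits n → ZMod 2) :
    QueryTree n → Finset (Bits n)
  | output a => {a}
  | queryF y next => insert y (points f G (next (f y)))
  | queryG p next => points f G (next (G p))

/-- The points at which the run can depend on `f`, when `G` depends on `f` only through the
correct values: those of `points f G` and the preimages of the rows of the `G`-queries. -/
def touched (f : Equiv.Perm (Bits n)) (G : Bits n × Bits n → ZMod 2) :
    QueryTree n → Finset (Bits n)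
  | output a => {a}
  | queryF y next => insert y (touched f G (next (f y)))
  | queryG p next => insert (f.symm p.1) (touched f G (next (G p)))

variable (f : Equiv.Perm (Bits n)) (G : Bits n × Bits n → ZMod 2) (t : QueryTree n)

theorem points_subset_touched : t.points f G ⊆ t.touched f G := by
  induction t with
  | output a => exact subset_rfl
  | queryF y _ ih => exact Finset.insert_subset_insert y (ih _)
  | queryG _ _ ih => exact (ih _).trans (Finset.subset_insert _ _)

theorem card_touched_trunc_le (s m : ℕ) : ((t.trunc s m).touched f G).card ≤ s + m + 1 := by
  induction t generalizing s m with
  | output a => exact (Finset.card_singleton a).trans_le (Nat.le_add_left 1 _)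
  | queryF y next ih =>
    obtain _ | s := s
    · exact (Finset.card_singleton 0).trans_le (Nat.le_add_left 1 _)
    · exact (Finset.card_insert_le _ _).trans (by linarith [ih (f y) s m])
  | queryG p next ih =>
    obtain _ | m := m
    · unfold trunc
      exact (Finset.card_singleton 0).trans_le (Nat.le_add_left 1 _)
    · exact (Finset.card_insert_le _ _).trans (by linarith [ih (G p) s m])

theorem run_mem_points_trunc {s m : ℕ} (hs : t.numF f G ≤ s) (hm : t.numG f G ≤ m) :
    t.run f G ∈ (t.trunc s m).points f G := by
  induction t generalizing s m with
  | output a => exact Finset.mem_singleton_self a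
  | queryF y next ih =>
    obtain _ | s := s
    · exact absurd hs (Nat.not_succ_le_zero _)
    · exact Finset.mem_insert_of_mem (ih _ (Nat.le_of_succ_le_succ hs) hm)
  | queryG p next ih =>
    obtain _ | m := m
    · exact absurd hm (Nat.not_succ_le_zero _)
    · exact ih _ hs (Nat.le_of_succ_le_succ hm)

theorem decisionDepthLE_points_trunc (s m : ℕ) :
    DecisionDepthLE m fun G => (t.trunc s m).points f G := by
  induction t generalizing s m with
  | output a => exact .const m ({a} : Finset (Bits n))
  | queryF y next ih =>
    obtain _ | s := s
    · exact .const m ({0} : Finset (Bits n))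
    · exact (ih (f y) s m).comp (insert y)
  | queryG p next ih =>
    obtain _ | m := m
    · unfold trunc
      exact .const 0 ({0} : Finset (Bits n))
    · refine .query p fun v => ?_
      simpa only [trunc, points, Function.update_self] using (ih v s m).comp_update p v

variable {f G t}

theorem mem_points_of_agree {f' : Equiv.Perm (Bits n)} {G' : Bits n × Bits n → ZMod 2}
    {a a₀ : Bits n} (hf : ∀ y, y ≠ a → y ≠ a₀ → f' y = f y)
    (hG : ∀ p : Bits n × Bits n, p.1 ≠ f a₀ → G' p = G p)
    (ha : a ∈ t.points f G) (ha₀ : a₀ ∉ t.touched f G) : a ∈ t.points f' G' := by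
  induction t with
  | output => exact ha
  | queryF y next ih =>
    simp only [points, touched, Finset.mem_insert, not_or] at ha ha₀ ⊢
    refine or_iff_not_imp_left.2 fun hay => ?_
    rw [hf y (Ne.symm hay) (Ne.symm ha₀.1)]
    exact ih _ (ha.resolve_left hay) ha₀.2
  | queryG p next ih =>
    simp only [points, touched, Finset.mem_insert, not_or] at ha ha₀ ⊢
    rw [hG p fun hp => ha₀.1 (f.symm_apply_eq.2 hp).symm]
    exact ih _ ha ha₀.2

end QueryTree
section UniformProbability

variable {α : Type*} [Fintype α]

theorem prob_eq_expect (p : α → Prop) [DecidablePred p] :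
    prob p = 𝔼 a, if p a then (1 : ℝ) else 0 := by
  rw [Fintype.expect_eq_sum_div_card, Finset.sum_boole, prob, Nat.card_eq_fintype_card,
    Fintype.card_subtype]

theorem prob_mem (S : Finset α) : prob (fun a => a ∈ S) = S.card / Fintype.card α := by
  rw [prob, Nat.card_eq_fintype_card, Fintype.card_coe]

theorem prob_mem_Icc (p : α → Prop) : prob p ∈ Set.Icc 0 1 := by
  classical
  refine ⟨by unfold prob; positivity, div_le_one_of_le₀ ?_ (Nat.cast_nonneg _)⟩
  rw [Nat.card_eq_fintype_card]
  exact_mod_cast Fintype.card_subtype_le p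

theorem prob_mono {p p' : α → Prop} (h : ∀ a, p a → p' a) : prob p ≤ prob p' := by
  unfold prob
  gcongr
  exact Nat.card_le_card_of_injective _ (Subtype.impEmbedding p p' h).injective

theorem prob_true [Nonempty α] : prob (fun _ : α => True) = 1 := by
  simp [prob]

theorem prob_comp_equiv {β : Type*} [Fintype β] (e : α ≃ β) (p : β → Prop) :
    prob (fun a => p (e a)) = prob p := by
  unfold prob
  rw [Fintype.card_congr e, Nat.card_congr (e.subtypeEquiv fun _ => Iff.rfl)]

theorem prob_prod {β : Type*} [Fintype β] (p : α × β → Prop) :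
    prob p = 𝔼 a, prob fun b => p (a, b) := by
  classical
  simp only [prob_eq_expect, ← Finset.univ_product_univ, Finset.expect_product]

theorem productMean_prob {ι γ : Type*} [Fintype ι] [Fintype γ] [DecidableEq ι] (k : ι → γ → ℝ)
    (p : α → (ι → γ) → Prop) :
    productMean k (fun g => prob fun a => p a g) = 𝔼 a, productProb k {g | p a g} := by
  classical
  simp only [prob_eq_expect, productMean_expect, productProb]
  exact Finset.expect_congr rfl fun a _ => congrArg _ <| funext fun g => by
    by_cases hg : p a g <;> simp [hg]

theorem sq_expect_le_expect_sq [Nonempty α] (F : α → ℝ) : (𝔼 a, F a) ^ 2 ≤ 𝔼 a, F a ^ 2 := by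
  simpa [Fintype.expect_const] using Finset.expect_mul_sq_le_sq_mul_sq Finset.univ F fun _ => 1

end UniformProbability

section Exchange

variable {α : Type*} [DecidableEq α]

/-- Exchange the preimage of `b` under a permutation with another point: the point `a₀` becomes
the new preimage, and the old one is returned. -/
def exchange (b : α) (q : Equiv.Perm α × α) : Equiv.Perm α × α :=
  (q.1 * Equiv.swap (q.1.symm b) q.2, q.1.symm b)

theorem exchange_involutive (b : α) : Function.Involutive (exchange b) := by
  rintro ⟨f, a₀⟩
  have preimage : (f * Equiv.swap (f.symm b) a₀).symm b = a₀ := by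
    simp [Equiv.symm_apply_eq]
  simp only [exchange, preimage, Equiv.swap_comm a₀, mul_assoc, Equiv.swap_mul_self, mul_one]

theorem exchange_apply_of_ne {b : α} {f : Equiv.Perm α} {a₀ y : α} (hy : y ≠ f.symm b)
    (hy₀ : y ≠ a₀) : (exchange b (f, a₀)).1 y = f y := by
  simp only [exchange, Equiv.Perm.mul_apply, Equiv.swap_apply_of_ne_of_ne hy hy₀]

theorem exchange_symm_apply_of_ne {b : α} {f : Equiv.Perm α} {a₀ z : α} (hz : z ≠ b)
    (hz₀ : z ≠ f a₀) : (exchange b (f, a₀)).1.symm z = f.symm z := by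
  rw [Equiv.symm_apply_eq, exchange_apply_of_ne (f.symm.injective.ne hz), f.apply_symm_apply]
  exact fun h => hz₀ (f.symm_apply_eq.1 h)

end Exchange

variable {n : ℕ}

theorem QueryTree.prob_symm_mem_points_trunc_le (t : QueryTree n) (s m : ℕ) {b : Bits n}
    {G : Equiv.Perm (Bits n) → Bits n × Bits n → ZMod 2}
    (hG : ∀ f f' p, (p.1 ≠ b → f'.symm p.1 = f.symm p.1) → G f' p = G f p) :
    prob (fun f => f.symm b ∈ (t.trunc s m).points f (G f)) ≤
      2 * (s + m + 1) / Fintype.card (Bits n) := by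
  classical
  let τ := (exchange_involutive b).toPerm
  let I (q : Equiv.Perm (Bits n) × Bits n) : ℝ :=
    if q.2 ∈ (t.trunc s m).touched q.1 (G q.1) then 1 else 0
  have cover (f : Equiv.Perm (Bits n)) (a₀ : Bits n) :
      (if f.symm b ∈ (t.trunc s m).points f (G f) then (1 : ℝ) else 0) ≤
        I (f, a₀) + I (τ (f, a₀)) := by
    have nonneg (q) : 0 ≤ I q := by positivity
    split_ifs with hf
    · by_cases ha₀ : a₀ ∈ (t.trunc s m).touched f (G f)
      · linarith [nonneg (τ (f, a₀)), show I (f, a₀) = 1 from if_pos ha₀]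
      · -- A run of `f` that avoids `a₀` is also a run of the exchanged permutation, where the
        -- point found is the one that was exchanged.
        have touched := points_subset_touched _ _ _ <|
          mem_points_of_agree (fun y => exchange_apply_of_ne)
            (fun p hp => hG f _ p fun hpb => exchange_symm_apply_of_ne hpb hp) hf ha₀
        linarith [nonneg (f, a₀), show I (τ (f, a₀)) = 1 from if_pos touched]
    · linarith [nonneg (f, a₀), nonneg (τ (f, a₀))]
  have rare : 𝔼 q, I q ≤ (s + m + 1) / Fintype.card (Bits n) := by
    rw [← prob_eq_expect, prob_prod]
    refine Finset.expect_le Finset.univ_nonempty fun f _ => ?_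
    refine (prob_mem ((t.trunc s m).touched f (G f))).trans_le ?_
    gcongr
    exact_mod_cast card_touched_trunc_le f (G f) t s m
  calc prob (fun f => f.symm b ∈ (t.trunc s m).points f (G f))
      = 𝔼 q : Equiv.Perm (Bits n) × Bits n,
          if q.1.symm b ∈ (t.trunc s m).points q.1 (G q.1) then (1 : ℝ) else 0 := by
        rw [prob_eq_expect, ← Finset.univ_product_univ, Finset.expect_product]
        exact Finset.expect_congr rfl fun f _ => (Finset.expect_const Finset.univ_nonempty _).symm
    _ ≤ 𝔼 q, (I q + I (τ q)) := Finset.expect_le_expect fun q _ => cover q.1 q.2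
    _ = 𝔼 q, I q + 𝔼 q, I q := by
        rw [Finset.expect_add_distrib, Fintype.expect_equiv τ (fun q => I (τ q)) I fun _ => rfl]
    _ ≤ 2 * (s + m + 1) / Fintype.card (Bits n) := by
        rw [← two_mul, mul_div_assoc]
        gcongr

section NoisyPredictor

/-- The law of a random predictor with independent values: on the rows in `B` a value is correct
with probability `1 / 2 + β`, on the other rows it is a fair coin. -/
noncomputable def noisyLaw (β : ℝ) (B : Finset (Bits n)) (f : Equiv.Perm (Bits n))
    (p : Bits n × Bits n) : ZMod 2 → ℝ :=
  coin (if p.1 ∈ B then β else 0) (h ((tilde f).symm p))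

/-- The correct values on the rows in `B`, and `0` on the other rows. Added to noise whose law does
not depend on `f`, it gives a predictor of law `noisyLaw β B f`. -/
def signal (B : Finset (Bits n)) (f : Equiv.Perm (Bits n)) (p : Bits n × Bits n) : ZMod 2 :=
  if p.1 ∈ B then h ((tilde f).symm p) else 0

variable {β : ℝ} {B : Finset (Bits n)}

theorem noisyLaw_mem_stdSimplex (hβ : |β| ≤ 1 / 2) (f : Equiv.Perm (Bits n))
    (p : Bits n × Bits n) : noisyLaw β B f p ∈ stdSimplex ℝ (ZMod 2) := by
  refine coin_mem_stdSimplex ?_ _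
  split_ifs
  · exact hβ
  · norm_num

theorem chiSqLE_noisyLaw_erase (hβ : |β| ≤ 1 / 2) (b : Bits n) (f : Equiv.Perm (Bits n))
    (p : Bits n × Bits n) :
    ChiSqLE (1 + 4 * β ^ 2) (noisyLaw β B f p) (noisyLaw β (B.erase b) f p) := by
  by_cases hp : p.1 ∈ B ∧ p.1 = b
  · have biased : noisyLaw β B f p = coin β (h ((tilde f).symm p)) := by
      rw [noisyLaw, if_pos hp.1]
    have fair : noisyLaw β (B.erase b) f p = coin 0 (h ((tilde f).symm p)) := by
      rw [noisyLaw, if_neg (hp.2 ▸ Finset.notMem_erase _ _)]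
    rw [biased, fair]
    exact chiSqLE_coin β _ _
  · have same : noisyLaw β (B.erase b) f p = noisyLaw β B f p := by
      have mem_iff : p.1 ∈ B.erase b ↔ p.1 ∈ B := by grind
      simp only [noisyLaw, mem_iff]
    rw [same]
    exact chiSqLE_self (by nlinarith [sq_nonneg β]) (noisyLaw_mem_stdSimplex hβ f p)

theorem productProb_noisyLaw (β : ℝ) (B : Finset (Bits n)) (f : Equiv.Perm (Bits n))
    (S : Set (Bits n × Bits n → ZMod 2)) :
    productProb (noisyLaw β B f) S =
      productProb (fun p => coin (if p.1 ∈ B then β else 0) 0) {ν | ν + signal B f ∈ S} := by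
  refine (productMean_comp_equiv (e := fun p => Equiv.addRight (signal B f p))
    (fun p v => ?_) _).symm
  simp only [noisyLaw, signal, Equiv.coe_addRight]
  split_ifs
  · rw [← coin_add β 0 (h ((tilde f).symm p)), zero_add]
  · simp only [coin_zero]

theorem expect_productProb_points_le_of_notMem (hβ : |β| ≤ 1 / 2) {b : Bits n} (hb : b ∉ B)
    (t : QueryTree n) (s m : ℕ) :
    𝔼 f : Equiv.Perm (Bits n),
        productProb (noisyLaw β B f) {G | f.symm b ∈ (t.trunc s m).points f G} ≤
      2 * (s + m + 1) / Fintype.card (Bits n) := by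
  have signal_congr (f f' : Equiv.Perm (Bits n)) (p : Bits n × Bits n)
      (hp : p.1 ≠ b → f'.symm p.1 = f.symm p.1) : signal B f' p = signal B f p := by
    unfold signal
    split_ifs with hpB
    · exact congrArg (fun y => h (y, p.2)) (hp (ne_of_mem_of_not_mem hpB hb))
    · rfl
  let noise (p : Bits n × Bits n) := coin (if p.1 ∈ B then β else 0) 0
  have hnoise (p) : noise p ∈ stdSimplex ℝ (ZMod 2) := by
    refine coin_mem_stdSimplex ?_ 0
    split_ifs
    · exact hβ
    · norm_num
  calc 𝔼 f : Equiv.Perm (Bits n),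
        productProb (noisyLaw β B f) {G | f.symm b ∈ (t.trunc s m).points f G}
      = productMean noise fun ν =>
          prob fun f => f.symm b ∈ (t.trunc s m).points f (ν + signal B f) := by
        rw [productMean_prob]
        exact Finset.expect_congr rfl fun f _ => productProb_noisyLaw β B f _
    _ ≤ productMean noise fun _ => 2 * (s + m + 1) / Fintype.card (Bits n) :=
        productMean_mono (fun p => (hnoise p).1) fun ν => t.prob_symm_mem_points_trunc_le s m
          fun f f' p hp => congrArg (ν p + ·) (signal_congr f f' p hp)
    _ = 2 * (s + m + 1) / Fintype.card (Bits n) := productMean_const (fun p => (hnoise p).2) _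

theorem expect_productProb_points_le (hβ : |β| ≤ 1 / 2) (b : Bits n) (t : QueryTree n)
    (s m : ℕ) :
    𝔼 f : Equiv.Perm (Bits n),
        productProb (noisyLaw β B f) {G | f.symm b ∈ (t.trunc s m).points f G} ≤
      √((1 + 4 * β ^ 2) ^ m * (2 * (s + m + 1) / Fintype.card (Bits n))) := by
  refine Real.le_sqrt_of_sq_le ((sq_expect_le_expect_sq _).trans ?_)
  calc 𝔼 f : Equiv.Perm (Bits n),
        productProb (noisyLaw β B f) {G | f.symm b ∈ (t.trunc s m).points f G} ^ 2
      ≤ 𝔼 f : Equiv.Perm (Bits n), (1 + 4 * β ^ 2) ^ m *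
          productProb (noisyLaw β (B.erase b) f) {G | f.symm b ∈ (t.trunc s m).points f G} :=
        Finset.expect_le_expect fun f _ => DecisionDepthLE.sq_productProb_le
          (by nlinarith [sq_nonneg β]) (fun p => (noisyLaw_mem_stdSimplex hβ f p).2)
          (fun p => noisyLaw_mem_stdSimplex hβ f p) (fun p => chiSqLE_noisyLaw_erase hβ b f p)
          ((t.decisionDepthLE_points_trunc f s m).comp fun S => f.symm b ∈ S)
    _ ≤ _ := by
        rw [← Finset.mul_expect]
        gcongr
        exact expect_productProb_points_le_of_notMem hβ (Finset.notMem_erase b B) t s m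

end NoisyPredictor

section Predicting

variable {δ ε β : ℝ} {B : Finset (Bits n)} {f : Equiv.Perm (Bits n)}

theorem predicts_of_forall_isGood {G : Bits n × Bits n → ZMod 2}
    (hB : δ * Fintype.card (Bits n) ≤ B.card) (hG : ∀ y, f y ∈ B → IsGood ε f G y) :
    Predicts δ ε f G :=
  calc δ ≤ B.card / Fintype.card (Bits n) := by
        rwa [le_div_iff₀ (by exact_mod_cast Fintype.card_pos)]
    _ = prob fun y => f y ∈ B := by rw [prob_comp_equiv f (· ∈ B), prob_mem]
    _ ≤ prob fun y => IsGood ε f G y := prob_mono hG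

theorem productProb_not_isGood_le (hβ : |β| ≤ 1 / 2) (hε : ε ≤ β) {y : Bits n} (hy : f y ∈ B) :
    productProb (noisyLaw β B f) {G | ¬ IsGood ε f G y} ≤
      Real.exp (-2 * (β - ε) ^ 2 * Fintype.card (Bits n)) := by
  let N : ℝ := Fintype.card (Bits n)
  have hN : 0 < N := Nat.cast_pos.2 Fintype.card_pos
  let X (p : Bits n × Bits n) (v : ZMod 2) : ℝ := if v = h ((tilde f).symm p) then 1 else 0
  let row : Finset (Bits n × Bits n) := {f y} ×ˢ Finset.univ
  have card_row : (row.card : ℝ) = N := by simp [row, N]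
  have mean (x : Bits n) : ∑ v, noisyLaw β B f (f y, x) v * X (f y, x) v = 1 / 2 + β := by
    simp [noisyLaw, coin, hy, X]
  have deviation (G : Bits n × Bits n → ZMod 2) :
      ∑ p ∈ row, (X p (G p) - ∑ v, noisyLaw β B f p v * X p v) =
        (prob fun x => G (tilde f (y, x)) = h (y, x)) * N - (1 / 2 + β) * N := by
    rw [Finset.sum_product, Finset.sum_singleton, prob_eq_expect, Fintype.expect_eq_sum_div_card,
      div_mul_cancel₀ _ hN.ne', mul_comm _ N, ← nsmul_eq_mul, ← Finset.card_univ,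
      ← Finset.sum_const, ← Finset.sum_sub_distrib]
    exact Finset.sum_congr rfl fun x _ => by rw [mean]; simp [X, tilde]
  calc productProb (noisyLaw β B f) {G | ¬ IsGood ε f G y}
      ≤ productProb (noisyLaw β B f)
          {G | ∑ p ∈ row, (X p (G p) - ∑ v, noisyLaw β B f p v * X p v) ≤ -((β - ε) * N)} := by
        refine productProb_mono (fun p => (noisyLaw_mem_stdSimplex hβ f p).1) fun G hG => ?_
        rw [Set.mem_ofPred_eq, deviation]
        have bad : (prob fun x => G (tilde f (y, x)) = h (y, x)) < 1 / 2 + ε := not_le.1 hG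
        nlinarith
    _ ≤ Real.exp (-2 * ((β - ε) * N) ^ 2 / row.card) :=
        productProb_sum_le_le_exp (noisyLaw_mem_stdSimplex hβ f)
          (fun p v => by dsimp only [X]; split_ifs <;> simp) row
          (mul_nonneg (sub_nonneg.2 hε) hN.le)
    _ = Real.exp (-2 * (β - ε) ^ 2 * N) := by
        rw [card_row]
        congr 1
        field_simp

theorem productProb_not_isGood_eq_zero (hε : ε ≤ 1 / 2) {y : Bits n} (hy : f y ∈ B) :
    productProb (noisyLaw (1 / 2) B f) {G | ¬ IsGood ε f G y} = 0 := by
  refine productProb_eq_zero fun G hG => ?_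
  by_contra! positive
  have correct (x : Bits n) : G (tilde f (y, x)) = h (y, x) := by
    by_contra wrong
    refine positive (tilde f (y, x)) ?_
    simp [noisyLaw, coin, tilde, hy, show G (f y, x) ≠ h (y, x) from wrong]
  refine hG ?_
  simp only [IsGood, correct, prob_true]
  linarith

theorem one_sub_le_productProb_predicts (hβ : |β| ≤ 1 / 2)
    (hB : δ * Fintype.card (Bits n) ≤ B.card) {η : ℝ}
    (hη : ∀ y, f y ∈ B → productProb (noisyLaw β B f) {G | ¬ IsGood ε f G y} ≤ η) :
    1 - B.card * η ≤ productProb (noisyLaw β B f) {G | Predicts δ ε f G} := by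
  let rows : Finset (Bits n) := B.map f.symm.toEmbedding
  have mem_rows {y : Bits n} : y ∈ rows ↔ f y ∈ B := by simp [rows, Finset.mem_map_equiv]
  have nonneg (p) := (noisyLaw_mem_stdSimplex (B := B) hβ f p).1
  have failure : productProb (noisyLaw β B f) {G | Predicts δ ε f G}ᶜ ≤ B.card * η :=
    calc productProb (noisyLaw β B f) {G | Predicts δ ε f G}ᶜ
        ≤ productProb (noisyLaw β B f) (⋃ y ∈ rows, {G | ¬ IsGood ε f G y}) := by
          refine productProb_mono nonneg fun G hG => ?_
          by_contra good
          simp only [Set.mem_iUnion, Set.mem_ofPred_eq, exists_prop, not_exists, not_and_not_right,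
            mem_rows] at good
          exact hG (predicts_of_forall_isGood hB good)
      _ ≤ ∑ y ∈ rows, productProb (noisyLaw β B f) {G | ¬ IsGood ε f G y} :=
          productProb_biUnion_le nonneg rows _
      _ ≤ rows.card • η := Finset.sum_le_card_nsmul _ _ _ fun y hy => hη y (mem_rows.1 hy)
      _ = B.card * η := by rw [Finset.card_map, nsmul_eq_mul]
  have total := productProb_add_compl (fun p => (noisyLaw_mem_stdSimplex (B := B) hβ f p).2)
    {G | Predicts δ ε f G}
  linarith

theorem exists_bias_half_le_productProb_predicts (hε : 0 ≤ ε) (hε' : ε ≤ 1 / 2)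
    (hB : δ * Fintype.card (Bits n) ≤ B.card)
    (hN : 2 * Fintype.card (Bits n) ≤ Real.exp (2 * ε ^ 2 * Fintype.card (Bits n))) :
    ∃ β : ℝ, |β| ≤ 1 / 2 ∧ |β| ≤ 2 * ε ∧ ∀ f : Equiv.Perm (Bits n),
      1 / 2 ≤ productProb (noisyLaw β B f) {G | Predicts δ ε f G} := by
  -- No bias exceeds `1 / 2`, so for `ε > 1 / 4` the rows in `B` are made exactly correct.
  obtain small | large := le_or_gt ε (1 / 4)
  · have hβ : |2 * ε| ≤ 1 / 2 := by rw [abs_of_nonneg (by positivity)]; linarith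
    refine ⟨2 * ε, hβ, (abs_of_nonneg (by positivity)).le, fun f => ?_⟩
    refine le_trans ?_ <| one_sub_le_productProb_predicts hβ hB fun y hy =>
      productProb_not_isGood_le hβ (by linarith) hy
    have card_le : (B.card : ℝ) ≤ Fintype.card (Bits n) := by exact_mod_cast B.card_le_univ
    have union : B.card * Real.exp (-(2 * ε ^ 2 * Fintype.card (Bits n))) ≤ 1 / 2 := by
      rw [Real.exp_neg, ← div_eq_mul_inv, div_le_iff₀ (Real.exp_pos _)]
      linarith
    rw [show -2 * (2 * ε - ε) ^ 2 * (Fintype.card (Bits n) : ℝ) =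
      -(2 * ε ^ 2 * Fintype.card (Bits n)) by ring]
    linarith
  · have hβ : |(1 / 2 : ℝ)| ≤ 1 / 2 := by norm_num
    refine ⟨1 / 2, hβ, hβ.trans (by linarith), fun f => ?_⟩
    refine le_trans ?_ <| one_sub_le_productProb_predicts hβ hB fun y hy =>
      (productProb_not_isGood_eq_zero hε' hy).le
    norm_num

end Predicting

section Averaging

theorem hasSum_mul_expect {ι Ω : Type*} [Fintype ι] {w : Ω → ℝ} {F : Ω → ι → ℝ} {a : ι → ℝ}
    (hF : ∀ i, HasSum (fun ω => w ω * F ω i) (a i)) :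
    HasSum (fun ω => w ω * 𝔼 i, F ω i) (𝔼 i, a i) := by
  simpa only [Fintype.expect_eq_sum_div_card, mul_div_assoc', Finset.mul_sum] using
    (hasSum_sum fun i _ => hF i).div_const (Fintype.card ι : ℝ)

section PMF

variable {Ω : Type*} (μ : PMF Ω)

theorem hasSum_toReal : HasSum (fun ω => (μ ω).toReal) 1 := by
  have := ENNReal.hasSum_toReal μ.tsum_coe_ne_top
  rwa [← ENNReal.tsum_toReal_eq μ.apply_ne_top, μ.tsum_coe, ENNReal.toReal_one] at this

theorem summable_toReal_mul {F : Ω → ℝ} (hF : ∀ ω, F ω ∈ Set.Icc 0 1) :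
    Summable fun ω => (μ ω).toReal * F ω :=
  (hasSum_toReal μ).summable.of_nonneg_of_le
    (fun ω => mul_nonneg ENNReal.toReal_nonneg (hF ω).1)
    fun ω => mul_le_of_le_one_right ENNReal.toReal_nonneg (hF ω).2

variable {μ}

theorem le_of_hasSum_toReal_mul {F : Ω → ℝ} {a C : ℝ}
    (hF : HasSum (fun ω => (μ ω).toReal * F ω) a) (hC : ∀ ω ∈ μ.support, F ω ≤ C) : a ≤ C := by
  refine hasSum_le (fun ω => ?_) hF (one_mul C ▸ (hasSum_toReal μ).mul_right C)
  by_cases hω : ω ∈ μ.support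
  · exact mul_le_mul_of_nonneg_left (hC ω hω) ENNReal.toReal_nonneg
  · simp [(PMF.apply_eq_zero_iff μ ω).2 hω]

end PMF

variable {ι α : Type*} [Fintype ι] [Fintype α] [DecidableEq ι] {k : ι → α → ℝ}

theorem hasSum_mul_productMean_indicator {Ω : Type*} {w : Ω → ℝ} {F : Ω → (ι → α) → ℝ}
    {a : (ι → α) → ℝ} (hF : ∀ g, HasSum (fun ω => w ω * F ω g) (a g)) (S : Set (ι → α)) :
    HasSum (fun ω => w ω * productMean k (S.indicator (F ω))) (productMean k (S.indicator a)) := by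
  simp only [← productMean_const_mul]
  refine hasSum_sum fun g _ => HasSum.mul_left _ ?_
  by_cases hg : g ∈ S
  · simpa only [Set.indicator_of_mem hg] using hF g
  · simpa only [Set.indicator_of_notMem hg, mul_zero] using hasSum_zero

theorem exists_mem_mul_productProb_le (hk : ∀ i v, 0 ≤ k i v) {S : Set (ι → α)}
    (hS : 0 < productProb k S) (F : (ι → α) → ℝ) :
    ∃ g ∈ S, F g * productProb k S ≤ productMean k (S.indicator F) := by
  have nonempty : S.Nonempty := by
    contrapose! hS
    exact (productProb_eq_zero fun g hg => by simp [hS] at hg).le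
  obtain ⟨g, hg, minimal⟩ := S.exists_min_image F S.toFinite nonempty
  refine ⟨g, hg, ?_⟩
  rw [productProb, ← productMean_const_mul]
  refine productMean_mono hk fun g' => ?_
  by_cases hg' : g' ∈ S
  · simpa [hg'] using minimal g' hg'
  · simp [hg']

end Averaging

section Inversion

/-- The probability that the deterministic algorithm `D` finds the preimage under `f` of a
random challenge, when its black boxes are `f` and `G`. -/
noncomputable def inversionProb (f : Equiv.Perm (Bits n)) (G : Bits n × Bits n → ZMod 2)
    (D : DetAlg n) : ℝ :=
  prob fun a => (D (f a)).run f G = a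

/-- The mean of `inversionProb f G` over the coins of a probabilistic algorithm. -/
noncomputable def meanInversionProb (A : RandAlg n) (f : Equiv.Perm (Bits n))
    (G : Bits n × Bits n → ZMod 2) : ℝ :=
  ∑' D, (A D).toReal * inversionProb f G D

theorem hasSum_meanInversionProb (A : RandAlg n) (f : Equiv.Perm (Bits n))
    (G : Bits n × Bits n → ZMod 2) :
    HasSum (fun D => (A D).toReal * inversionProb f G D) (meanInversionProb A f G) :=
  (summable_toReal_mul A fun _ => prob_mem_Icc _).hasSum

theorem meanInversionProb_nonneg (A : RandAlg n) (f : Equiv.Perm (Bits n))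
    (G : Bits n × Bits n → ZMod 2) : 0 ≤ meanInversionProb A f G :=
  (hasSum_meanInversionProb A f G).nonneg fun _ =>
    mul_nonneg ENNReal.toReal_nonneg (prob_mem_Icc _).1

theorem successProb_eq_expect (A : RandAlg n)
    (G : Equiv.Perm (Bits n) → Bits n × Bits n → ZMod 2) :
    successProb A G = 𝔼 f, meanInversionProb A f (G f) := by
  rw [← (hasSum_mul_expect fun f => hasSum_meanInversionProb A f (G f)).tsum_eq]
  simp only [successProb, prob_prod, inversionProb]

theorem inversionProb_le {f : Equiv.Perm (Bits n)} {G : Bits n × Bits n → ZMod 2} {D : DetAlg n}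
    {s m : ℕ} (hD : ∀ a, (D (f a)).numF f G ≤ s ∧ (D (f a)).numG f G ≤ m) :
    inversionProb f G D ≤ prob fun b => f.symm b ∈ ((D b).trunc s m).points f G := by
  rw [← prob_comp_equiv f]
  refine prob_mono fun a ha => ?_
  have run_mem := (D (f a)).run_mem_points_trunc f G (hD a).1 (hD a).2
  rw [ha] at run_mem
  rwa [f.symm_apply_apply]

variable {δ ε β : ℝ} {s m : ℕ}

theorem expect_productMean_inversionProb_le (hβ : |β| ≤ 1 / 2) (B : Finset (Bits n))
    {D : DetAlg n} (hD : ∀ (f : Equiv.Perm (Bits n)) (G : Bits n × Bits n → ZMod 2) (a : Bits n),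
      Predicts δ ε f G → (D (f a)).numF f G ≤ s ∧ (D (f a)).numG f G ≤ m) :
    𝔼 f : Equiv.Perm (Bits n), productMean (noisyLaw β B f)
        ({G | Predicts δ ε f G}.indicator fun G => inversionProb f G D) ≤
      2 * (s + m + 1) / Fintype.card (Bits n) + B.card / Fintype.card (Bits n) *
        √((1 + 4 * β ^ 2) ^ m * (2 * (s + m + 1) / Fintype.card (Bits n))) := by
  let ρ : ℝ := 2 * (s + m + 1) / Fintype.card (Bits n)
  let γ : ℝ := √((1 + 4 * β ^ 2) ^ m * ρ)
  have challenge (b : Bits n) :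
      𝔼 f : Equiv.Perm (Bits n),
        productProb (noisyLaw β B f) {G | f.symm b ∈ ((D b).trunc s m).points f G} ≤
      ρ + γ * if b ∈ B then 1 else 0 := by
    split_ifs with hb
    · have rho_nonneg : 0 ≤ ρ := by positivity
      linarith [expect_productProb_points_le hβ (B := B) b (D b) s m]
    · linarith [expect_productProb_points_le_of_notMem hβ hb (D b) s m]
  calc 𝔼 f : Equiv.Perm (Bits n), productMean (noisyLaw β B f)
        ({G | Predicts δ ε f G}.indicator fun G => inversionProb f G D)
      ≤ 𝔼 f : Equiv.Perm (Bits n), productMean (noisyLaw β B f) fun G =>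
          prob fun b => f.symm b ∈ ((D b).trunc s m).points f G :=
        Finset.expect_le_expect fun f _ =>
          productMean_mono (fun p => (noisyLaw_mem_stdSimplex hβ f p).1) <|
            Set.indicator_le' (fun G hG => inversionProb_le fun a => hD f G a hG)
              fun G _ => (prob_mem_Icc _).1
    _ = 𝔼 b : Bits n, 𝔼 f : Equiv.Perm (Bits n),
          productProb (noisyLaw β B f) {G | f.symm b ∈ ((D b).trunc s m).points f G} := by
        simp only [productMean_prob]
        exact Finset.expect_comm _ _ _
    _ ≤ 𝔼 b : Bits n, (ρ + γ * if b ∈ B then 1 else 0) :=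
        Finset.expect_le_expect fun b _ => challenge b
    _ = ρ + B.card / Fintype.card (Bits n) * γ := by
        rw [Finset.expect_add_distrib, Fintype.expect_const, ← Finset.mul_expect,
          ← prob_eq_expect, prob_mem, mul_comm]

theorem exists_predicts_successProb_le (hβ : |β| ≤ 1 / 2) {B : Finset (Bits n)}
    (hB : ∀ f, 1 / 2 ≤ productProb (noisyLaw β B f) {G | Predicts δ ε f G}) {A : RandAlg n}
    (hA : QueryBound δ ε A s m) :
    ∃ G : Equiv.Perm (Bits n) → Bits n × Bits n → ZMod 2, (∀ f, Predicts δ ε f (G f)) ∧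
      successProb A G ≤ 2 * (2 * (s + m + 1) / Fintype.card (Bits n) +
        B.card / Fintype.card (Bits n) *
          √((1 + 4 * β ^ 2) ^ m * (2 * (s + m + 1) / Fintype.card (Bits n)))) := by
  choose G hG average using fun f => exists_mem_mul_productProb_le
    (fun p => (noisyLaw_mem_stdSimplex hβ f p).1) (one_half_pos.trans_le (hB f))
    (meanInversionProb A f)
  refine ⟨G, hG, ?_⟩
  calc successProb A G = 𝔼 f, meanInversionProb A f (G f) := successProb_eq_expect A G
    _ ≤ 𝔼 f, 2 * productMean (noisyLaw β B f)
          ({G | Predicts δ ε f G}.indicator (meanInversionProb A f)) :=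
        Finset.expect_le_expect fun f _ => by
          nlinarith [average f, hB f, meanInversionProb_nonneg A f (G f)]
    _ ≤ _ := by
        rw [← Finset.mul_expect]
        gcongr
        exact le_of_hasSum_toReal_mul
          (hasSum_mul_expect fun f => hasSum_mul_productMean_indicator
            (hasSum_meanInversionProb A f) {G | Predicts δ ε f G})
          fun D hD => expect_productMean_inversionProb_le hβ B (hA D hD)

end Inversion

section Parameters

theorem card_bits (n : ℕ) : (Fintype.card (Bits n) : ℝ) = ((2 : ℝ) ^ ((n : ℝ) / 2)) ^ 2 := by
  rw [← Real.rpow_mul_natCast zero_le_two, Nat.cast_ofNat, div_mul_cancel₀ _ two_ne_zero,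
    Real.rpow_natCast]
  simp [ZMod.card]

theorem one_le_mul_two_rpow_half {δ : ℝ} (hδ : (2 : ℝ) ^ (-(n : ℝ) / 2) ≤ δ) :
    1 ≤ δ * (2 : ℝ) ^ ((n : ℝ) / 2) := by
  rwa [neg_div, Real.rpow_neg zero_le_two, inv_le_iff_one_le_mul₀ (by positivity)] at hδ

theorem le_sq_mul_two_rpow_half {ε : ℝ} (hε : √n * (2 : ℝ) ^ (-(n : ℝ) / 4) ≤ ε) :
    n ≤ ε ^ 2 * (2 : ℝ) ^ ((n : ℝ) / 2) := by
  have quarter_sq : ((2 : ℝ) ^ ((n : ℝ) / 4)) ^ 2 = 2 ^ ((n : ℝ) / 2) := by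
    rw [← Real.rpow_mul_natCast zero_le_two]
    ring_nf
  rw [neg_div, Real.rpow_neg zero_le_two, ← div_eq_mul_inv, div_le_iff₀ (by positivity)] at hε
  rw [← quarter_sq, ← mul_pow]
  exact (Real.sqrt_le_left ((Real.sqrt_nonneg _).trans hε)).1 hε

theorem exp_quarter_le_two_rpow_half (n : ℕ) :
    Real.exp (n / 4) ≤ (2 : ℝ) ^ ((n : ℝ) / 2) := by
  rw [Real.rpow_def_of_pos two_pos, Real.exp_le_exp]
  nlinarith [Real.log_two_gt_d9, n.cast_nonneg (α := ℝ)]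

theorem eleven_le_of_four_mul_le (hn : n ≠ 0) (h : 4 * n ≤ (2 : ℝ) ^ ((n : ℝ) / 2)) :
    11 ≤ n := by
  have square : (4 * n : ℝ) ^ 2 ≤ 2 ^ n := by
    calc (4 * n : ℝ) ^ 2 ≤ ((2 : ℝ) ^ ((n : ℝ) / 2)) ^ 2 := by gcongr
      _ = 2 ^ n := by rw [← card_bits]; simp [ZMod.card]
  have square_nat : (4 * n) ^ 2 ≤ 2 ^ n := by exact_mod_cast square
  by_contra! lt
  interval_cases n <;> simp_all

theorem two_mul_card_bits_le_exp (hn : n ≠ 0) {ε : ℝ}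
    (hε : n ≤ ε ^ 2 * (2 : ℝ) ^ ((n : ℝ) / 2)) :
    2 * Fintype.card (Bits n) ≤ Real.exp (2 * ε ^ 2 * Fintype.card (Bits n)) := by
  have hn' : (1 : ℝ) ≤ n := by exact_mod_cast Nat.one_le_iff_ne_zero.2 hn
  have hM : 1 ≤ (2 : ℝ) ^ ((n : ℝ) / 2) := Real.one_le_rpow one_le_two (by positivity)
  calc 2 * (Fintype.card (Bits n) : ℝ) = 2 ^ (n + 1) := by simp [ZMod.card, pow_succ']
    _ ≤ Real.exp 1 ^ (n + 1) := by gcongr; linarith [Real.add_one_le_exp (1 : ℝ)]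
    _ = Real.exp (n + 1) := by rw [Real.exp_one_pow, Nat.cast_add_one]
    _ ≤ Real.exp (2 * ε ^ 2 * Fintype.card (Bits n)) := by
        rw [Real.exp_le_exp, card_bits]
        nlinarith

theorem five_mul_one_add_pow_le_exp (hn : 11 ≤ n) {β ε : ℝ} (hβ : |β| ≤ 2 * ε) {m : ℕ}
    (hm : ε ^ 2 * m ≤ n / 1000) : 5 * (1 + 4 * β ^ 2) ^ m ≤ Real.exp (n / 4) := by
  have hn' : (11 : ℝ) ≤ n := by exact_mod_cast hn
  have five_le : 5 ≤ Real.exp 2 := by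
    rw [← one_add_one_eq_two, Real.exp_add]
    nlinarith [Real.exp_one_gt_d9]
  have sq_le : β ^ 2 ≤ (2 * ε) ^ 2 := sq_le_sq' (abs_le.1 hβ).1 (abs_le.1 hβ).2
  calc 5 * (1 + 4 * β ^ 2) ^ m ≤ Real.exp 2 * Real.exp (16 * ε ^ 2) ^ m := by
        gcongr
        linarith [Real.add_one_le_exp (16 * ε ^ 2)]
    _ = Real.exp (2 + m * (16 * ε ^ 2)) := by rw [Real.exp_add, Real.exp_nat_mul]
    _ ≤ Real.exp (n / 4) := Real.exp_le_exp.2 (by linarith)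

theorem success_bound_lt {M δ TF TG b κ : ℝ} (hM : 44 ≤ M) (hδ : 1 ≤ δ * M) (hTF : TF ≤ M / 1000)
    (hTG : TG ≤ M / 1000) (hb : b ≤ δ * M ^ 2 + 1) (hκ₀ : 0 ≤ κ) (hκ : 5 * κ ≤ M) :
    2 * (2 * (TF + TG + 1) / M ^ 2 + b / M ^ 2 * √(κ * (2 * (TF + TG + 1) / M ^ 2))) < δ / 2 := by
  have hM₀ : 0 < M := by linarith
  have hδ₀ : 0 < δ := pos_of_mul_pos_left (one_pos.trans_le hδ) hM₀.le
  have blind : 2 * (TF + TG + 1) / M ^ 2 ≤ 1 / (20 * M) := by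
    rw [div_le_div_iff₀ (by positivity) (by positivity)]
    nlinarith
  have blind_le : 1 / (20 * M) ≤ δ / 20 := by
    rw [div_le_div_iff₀ (by positivity) (by positivity)]
    linarith
  have informed : √(κ * (2 * (TF + TG + 1) / M ^ 2)) ≤ 1 / 10 := by
    refine Real.sqrt_le_iff.2 ⟨by norm_num, (mul_le_mul_of_nonneg_left blind hκ₀).trans ?_⟩
    rw [mul_one_div, div_le_iff₀ (by positivity)]
    linarith
  have fraction : b / M ^ 2 ≤ δ + δ / 44 := by
    rw [div_le_iff₀ (by positivity)]
    nlinarith [mul_le_mul hδ hM (by norm_num) (by positivity)]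
  have product : b / M ^ 2 * √(κ * (2 * (TF + TG + 1) / M ^ 2)) ≤ (δ + δ / 44) * (1 / 10) := by
    gcongr
  linarith

end Parameters

theorem exists_finset_card_approx {α : Type*} [Fintype α] {δ : ℝ} (hδ : 0 ≤ δ) (hδ' : δ ≤ 1) :
    ∃ B : Finset α, δ * Fintype.card α ≤ B.card ∧ B.card ≤ δ * Fintype.card α + 1 := by
  obtain ⟨B, -, hB⟩ := Finset.exists_subset_card_eq (s := (Finset.univ : Finset α))
    (n := ⌈δ * Fintype.card α⌉₊) <|
      Nat.ceil_le.2 (mul_le_of_le_one_left (Nat.cast_nonneg _) hδ')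
  refine ⟨B, ?_, ?_⟩ <;> rw [hB]
  · exact Nat.le_ceil _
  · exact (Nat.ceil_lt_add_one (by positivity)).le

theorem exists_predicts_successProb_lt {δ ε : ℝ} (hδ : (2 : ℝ) ^ (-(n : ℝ) / 2) ≤ δ)
    (hδ' : δ ≤ 1) (hε : √n * (2 : ℝ) ^ (-(n : ℝ) / 4) ≤ ε) (hε' : ε ≤ 1 / 2) {A : RandAlg n}
    {TF TG : ℕ} (hA : QueryBound δ ε A TF TG) (hTF : TF < 1 / 1000 * (2 : ℝ) ^ ((n : ℝ) / 2))
    (hTG : TG < 1 / 1000 * (n / ε ^ 2)) :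
    ∃ G : Equiv.Perm (Bits n) → Bits n × Bits n → ZMod 2,
      (∀ f, Predicts δ ε f (G f)) ∧ successProb A G < δ / 2 := by
  let M : ℝ := 2 ^ ((n : ℝ) / 2)
  have hn₀ : n ≠ 0 := by
    rintro rfl
    exact absurd hTG (by simp)
  have hε₀ : 0 < ε := lt_of_lt_of_le (by positivity) hε
  have hεM : n ≤ ε ^ 2 * M := le_sq_mul_two_rpow_half hε
  have four_mul_le : 4 * n ≤ M := by
    have sq_le : ε ^ 2 ≤ 1 / 4 := by nlinarith
    nlinarith [show 0 < M by positivity]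
  have hn : 11 ≤ n := eleven_le_of_four_mul_le hn₀ four_mul_le
  have hM : 44 ≤ M := by
    have : (11 : ℝ) ≤ n := by exact_mod_cast hn
    linarith
  have hTGε : ε ^ 2 * TG ≤ n / 1000 := by
    rw [mul_div_assoc', lt_div_iff₀ (by positivity)] at hTG
    linarith
  have hTGM : TG ≤ M / 1000 := by nlinarith [sq_pos_of_pos hε₀]
  obtain ⟨B, hB, hB'⟩ := exists_finset_card_approx (α := Bits n) (le_trans (by positivity) hδ) hδ'
  obtain ⟨β, hβ, hβε, predicts⟩ :=
    exists_bias_half_le_productProb_predicts hε₀.le hε' hB (two_mul_card_bits_le_exp hn₀ hεM)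
  obtain ⟨G, hG, success⟩ := exists_predicts_successProb_le hβ predicts hA
  refine ⟨G, hG, success.trans_lt ?_⟩
  rw [card_bits] at hB' ⊢
  exact success_bound_lt hM (one_le_mul_two_rpow_half hδ) (by linarith) hTGM hB' (by positivity)
    ((five_mul_one_add_pow_le_exp hn hβε hTGε).trans (exp_quarter_le_two_rpow_half n))

end GLStar

theorem theorem5 :
    ∃ c : ℝ, 0 < c ∧
      ∀ (n : ℕ) (δ ε : ℝ),
        (2 : ℝ) ^ (-(n : ℝ) / 2) ≤ δ → δ ≤ 1 →
        Real.sqrt (n : ℝ) * (2 : ℝ) ^ (-(n : ℝ) / 4) ≤ ε → ε ≤ 1 / 2 →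
        ∀ (A : GLStar.RandAlg n) (TF TG : ℕ),
          GLStar.Solves δ ε A → GLStar.QueryBound δ ε A TF TG →
            c * (2 : ℝ) ^ ((n : ℝ) / 2) ≤ (TF : ℝ) ∨ c * ((n : ℝ) / ε ^ 2) ≤ (TG : ℝ) := by
  refine ⟨1 / 1000, by norm_num, fun n δ ε hδ hδ' hε hε' A TF TG solves bound => ?_⟩
  by_contra! ⟨hTF, hTG⟩
  obtain ⟨G, predicts, fails⟩ :=
    GLStar.exists_predicts_successProb_lt hδ hδ' hε hε' bound hTF hTG
  exact fails.not_ge (solves G predicts)
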